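/- **Proposition (local Franks lemma for Hamiltonians).** Let $d,n\ge 0$ be integers. Equip $\mathbb R^{2d+2+n}$, with coordinates $(x_1,\dots,x_{d+1},y_1,\dots,y_{d+1},z_1,\dots,z_n)$, with the Poisson structure $\pi_0=\sum_{i=1}^{d+1}\frac{\partial}{\partial x_i}\wedge\frac{\partial}{\partial y_i}$. For a $C^2$ function $H$ let $X_H=\pi_0(\cdot,dH)$, i.e. $\dot x_i=\partial H/\partial y_i$, $\dot y_i=-\partial H/\partial x_i$, $\dot z_k=0$, and let $\varphi_H^t$ be its (local) flow. Let $H_0=y_1$, so that $X_{H_0}=\partial/\partial x_1$, with the orbit segment $\Gamma_0=[0,1]\times\{0\}$ from $p=0$ to $p'=(1,0,\dots,0)$, and fix the transversals $\Sigma_0=\{x_1=0,\,y_1=0,\,z=0\}$ and $\Sigma_0'=\{x_1=1,\,y_1=0,\,z=0\}$, both with coordinates $(x_2,\dots,x_{d+1},y_2,\dots,y_{d+1})\in\mathbb R^{2d}$. The Poincaré map $P_H$ of $H$ at $p$ between $\Sigma_0$ and $\Sigma_0'$ is the $C^1$ symplectomorphism $P_H(w)=\varphi_H^{\tau(w)}(w)$,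 $\tau(w)=\min\{t\ge 0:\varphi_H^t(w)\in\Sigma_0'\}$, from a neighbourhood of $p$ in $\Sigma_0$ onto its image in $\Sigma_0'$, with $\tau$ bounded and $C^1$ and $P_H(p)=p'$. Here it is required that, near $p$ and $p'$ respectively, $\Sigma_0$ and $\Sigma_0'$ are transversals for $H$: each is contained in the intersection of the energy surface (the connected component of a level set of $H$) and the symplectic leaf through that point, and its tangent space there is complementary to $\mathbb R X_H$ in the tangent space of that intersection. Let $\|f\|_{C^2}$ be the largest of the suprema over $\mathbb R^{2d+2+n}$ of $|f|$ and of the absolute values of its first and second order partial derivatives, let $\|[a_{ij}]\|=\max_j\sum_i|a_{ij}|$, and let $\mathrm{Sp}(2d,\mathbb R)=\{A: A^T\mathbb J A=\mathbb J\}$ with $\mathbb J=\begin{pmatrix}0&-I\\ I&0\end{pmatrix}$. Let $B_\varrho$ be the Euclidean open ball of radius $\varrho>0$ centered at the origin, and put $D=(\mathbb R^{2d+2+n}\setminus B_\varrho)\cup\Gamma_0$. Then for every $\varepsilon>0$ there is $\delta>0$ (depending on $\varepsilon$, $\varrho$, $d$, $n$) such that for every $A\in\mathrm{Sp}(2d,\mathbb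 R)$ with $\|A-I\|<\delta$ there is $H\in C^2(\mathbb R^{2d+2+n})$ with $$\|H-H_0\|_{C^2}<\varepsilon,\qquad X_H=X_{H_0}\ \text{ on } D,$$ whose Poincaré map $P_H$ between $\Sigma_0$ and $\Sigma_0'$ is defined near $p$ and satisfies $D_pP_H=A$ in the above coordinates. -/

import Mathlib

open scoped ENNReal Topology

noncomputable section

namespace PoissonFranks

/-- Indices of the coordinates `(x₁, …, x_{d+1}, y₁, …, y_{d+1}, z₁, …, zₙ)`. -/
abbrev Idx (d n : ℕ) : Type := (Fin (d + 1) ⊕ Fin (d + 1)) ⊕ Fin n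

/-- `ℝ^{2d+2+n}` with the Euclidean norm. -/
abbrev Phase (d n : ℕ) : Type := EuclideanSpace ℝ (Idx d n)

/-- `ℝ^{2d}`, the coordinates `(x̂, ŷ)` on the transversals. -/
abbrev Trans (d : ℕ) : Type := Fin d ⊕ Fin d → ℝ

/-- The index of the coordinate `x_{i+1}`. -/
abbrev ix {d n : ℕ} (i : Fin (d + 1)) : Idx d n := Sum.inl (Sum.inl i)

/-- The index of the coordinate `y_{i+1}`. -/
abbrev iy {d n : ℕ} (i : Fin (d + 1)) : Idx d n := Sum.inl (Sum.inr i)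

/-- The index of the coordinate `z_{k+1}`. -/
abbrev iz {d n : ℕ} (k : Fin n) : Idx d n := Sum.inr k

/-- The coordinate vector `∂/∂c`. -/
def basisVec {d n : ℕ} (c : Idx d n) : Phase d n := EuclideanSpace.single c (1 : ℝ)

/-- The canonical Poisson structure `π₀ = ∑ᵢ ∂/∂xᵢ ∧ ∂/∂yᵢ` (`1 ≤ i ≤ d + 1`), evaluated on two
covectors. -/
def canonicalPoisson {d n : ℕ} (ξ η : Phase d n →L[ℝ] ℝ) : ℝ :=
  ∑ i : Fin (d + 1),
    (ξ (basisVec (ix i)) * η (basisVec (iy i)) - ξ (basisVec (iy i)) * η (basisVec (ix i)))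

/-- The Hamiltonian vector field `X_H = π₀(·, dH)`: its component along a coordinate `c` is
`π₀(dc, dH)`, so `ẋᵢ = ∂H/∂yᵢ`, `ẏᵢ = -∂H/∂xᵢ`, `żₖ = 0`. -/
def hamVF {d n : ℕ} (H : Phase d n → ℝ) (p : Phase d n) : Phase d n :=
  WithLp.toLp 2 fun c => canonicalPoisson (EuclideanSpace.proj c) (fderiv ℝ H p)

/-- The Hamiltonian `H₀ = y₁`. -/
def H₀ {d n : ℕ} (p : Phase d n) : ℝ := p (iy 0)

/-- The orbit segment `Γ₀ = [0,1] × {0}`. -/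
def Γ₀ (d n : ℕ) : Set (Phase d n) := {p | p (ix 0) ∈ Set.Icc (0 : ℝ) 1 ∧ ∀ c, c ≠ ix 0 → p c = 0}

/-- The partial derivative `∂f/∂c`. -/
def pderiv {d n : ℕ} (c : Idx d n) (f : Phase d n → ℝ) (p : Phase d n) : ℝ :=
  fderiv ℝ f p (basisVec c)

/-- The `C^0` norm, possibly infinite. -/
def normC0 {d n : ℕ} (f : Phase d n → ℝ) : ℝ≥0∞ := ⨆ p, ‖f p‖ₑ

/-- The `C^2` norm on `ℝ^{2d+2+n}`: the largest of the `C^0` norms of the function and of its first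
and second order partial derivatives, possibly infinite. -/
def normC2 {d n : ℕ} (f : Phase d n → ℝ) : ℝ≥0∞ :=
  max (normC0 f)
    (max (⨆ c, normC0 (pderiv c f)) (⨆ c, ⨆ c', normC0 (pderiv c (pderiv c' f))))

/-- `B_ε(H, D)`: the `C^2` Hamiltonians `H'` with `‖H' - H‖_{C²} < ε` and `X_{H'} = X_H` on `D`. -/
def hamBall {d n : ℕ} (ε : ℝ) (H : Phase d n → ℝ) (D : Set (Phase d n)) : Set (Phase d n → ℝ) :=
  {H' | ContDiff ℝ 2 H' ∧ normC2 (fun p => H' p - H p) < ENNReal.ofReal ε ∧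
    ∀ p ∈ D, hamVF H' p = hamVF H p}

/-- The matrix norm `‖[a_{ij}]‖ = max_j ∑_i |a_{ij}|` (it is `0` for the empty matrix). -/
def matNorm {d : ℕ} (A : Matrix (Fin d ⊕ Fin d) (Fin d ⊕ Fin d) ℝ) : ℝ := ⨆ j, ∑ i, |A i j|

/-- `φ_H^t(p) = q` for a time `t ≥ 0`: the solution of `γ' = X_H(γ)` with `γ(0) = p` exists on
`[0,t]` and `γ(t) = q`. For `H` of class `C^2` this `q` is unique. -/
def FlowsTo {d n : ℕ} (H : Phase d n → ℝ) (t : ℝ) (p q : Phase d n) : Prop :=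
  0 ≤ t ∧ ∃ γ : ℝ → Phase d n, γ 0 = p ∧ γ t = q ∧
    IsIntegralCurveOn γ (fun _ => hamVF H) (Set.Icc 0 t)

/-- The plane `{x₁ = s, y₁ = 0, z = 0}`. The fixed transversals are `Σ₀` (`s = 0`) and
`Σ₀'` (`s = 1`). -/
def section₀ (d n : ℕ) (s : ℝ) : Set (Phase d n) :=
  {p | p (ix 0) = s ∧ p (iy 0) = 0 ∧ ∀ k, p (iz k) = 0}

/-- The point of `{x₁ = s, y₁ = 0, z = 0}` with coordinates `(x̂, ŷ) = w`. -/
def sectionPt {d : ℕ} (n : ℕ) (s : ℝ) (w : Trans d) : Phase d n :=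
  WithLp.toLp 2 (Sum.elim
    (Sum.elim (Fin.cons s fun i => w (Sum.inl i)) (Fin.cons 0 fun i => w (Sum.inr i)))
    fun _ => 0)

/-- The tangent space of `{x₁ = s, y₁ = 0, z = 0}`, spanned by the `∂/∂xᵢ`, `∂/∂yᵢ` with `i ≥ 2`. -/
def sectionTangent (d n : ℕ) : Submodule ℝ (Phase d n) :=
  Submodule.span ℝ (Set.range fun i : Fin d => basisVec (ix i.succ)) ⊔
    Submodule.span ℝ (Set.range fun i : Fin d => basisVec (iy i.succ))

/-- The symplectic leaf of `π₀` through `p`. -/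
def leaf {d n : ℕ} (p : Phase d n) : Set (Phase d n) := {q | ∀ k, q (iz k) = p (iz k)}

/-- The tangent space of the symplectic leaves, spanned by all the `∂/∂xᵢ`, `∂/∂yᵢ`. -/
def leafTangent (d n : ℕ) : Submodule ℝ (Phase d n) :=
  Submodule.span ℝ (Set.range fun i : Fin (d + 1) => basisVec (ix i)) ⊔
    Submodule.span ℝ (Set.range fun i : Fin (d + 1) => basisVec (iy i))

/-- The energy surface through `p`: the connected component of `H⁻¹(H(p))` that contains `p`. -/
def energySurface {d n : ℕ} (H : Phase d n → ℝ) (p : Phase d n) : Set (Phase d n) :=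
  connectedComponentIn {q | H q = H p} p

/-- Near `p = (s, 0, …, 0)`, the plane `Σ = {x₁ = s, y₁ = 0, z = 0}` is a transversal to the flow
of `H` at `p` in `ℰ ∩ S`, where `ℰ` is the energy surface and `S` the symplectic leaf through `p`:
it lies in `ℰ ∩ S` and `T_p(ℰ ∩ S) = T_pΣ ⊕ ℝ X_H(p)`. -/
structure IsTransversal {d n : ℕ} (H : Phase d n → ℝ) (s : ℝ) : Prop where
  subset : ∀ᶠ q in 𝓝[section₀ d n s] (sectionPt n s 0),
    q ∈ energySurface H (sectionPt n s 0) ∩ leaf (sectionPt n s 0)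
  tangent_eq :
    LinearMap.ker (fderiv ℝ H (sectionPt n s 0)).toLinearMap ⊓ leafTangent d n =
      sectionTangent d n ⊔ Submodule.span ℝ {hamVF H (sectionPt n s 0)}
  disjoint : Disjoint (sectionTangent d n) (Submodule.span ℝ {hamVF H (sectionPt n s 0)})

/-- In the coordinates `(x̂, ŷ)` of `Σ₀` and `Σ₀'`, the map `P` on the open neighbourhood `U` of the
origin is the Poincaré map of `H` at the origin, with return time `τ`:
`P(w) = φ_H^{τ(w)}(w)` and `τ(w) = min {t ≥ 0 : φ_H^t(w) ∈ Σ₀'}`. It takes `p = 0` to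
`p' = (1, 0, …, 0)`, `τ` is `C^1` and bounded, and `P` is a `C^1` symplectomorphism onto its
image. -/
structure IsPoincareMap {d n : ℕ} (H : Phase d n → ℝ) (U : Set (Trans d)) (τ : Trans d → ℝ)
    (P : Trans d → Trans d) : Prop where
  isOpen : IsOpen U
  zero_mem : (0 : Trans d) ∈ U
  transversal_start : IsTransversal (n := n) H 0
  transversal_end : IsTransversal (n := n) H 1
  time_isLeast : ∀ w ∈ U,
    IsLeast {t : ℝ | ∃ q ∈ section₀ d n 1, FlowsTo H t (sectionPt n 0 w) q} (τ w)
  flowsTo : ∀ w ∈ U, FlowsTo H (τ w) (sectionPt n 0 w) (sectionPt n 1 (P w))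
  map_zero : P 0 = 0
  time_contDiffOn : ContDiffOn ℝ 1 τ U
  time_bounded : ∃ C : ℝ, ∀ w ∈ U, τ w ≤ C
  contDiffOn : ContDiffOn ℝ 1 P U
  injOn : Set.InjOn P U
  symplectic : ∀ w ∈ U,
    LinearMap.toMatrix' (fderiv ℝ P w).toLinearMap ∈ Matrix.symplecticGroup (Fin d) ℝ

/-- `B` is the linear Poincaré map `D_pP_H` at the origin `p`, as a matrix in the coordinates
`(x̂, ŷ)` of the fixed transversals `Σ₀` and `Σ₀'`. -/
def IsLinearPoincareMap {d n : ℕ} (H : Phase d n → ℝ)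
    (B : Matrix (Fin d ⊕ Fin d) (Fin d ⊕ Fin d) ℝ) : Prop :=
  ∃ (U : Set (Trans d)) (τ : Trans d → ℝ) (P : Trans d → Trans d),
    IsPoincareMap H U τ P ∧ HasFDerivAt P (LinearMap.toContinuousLinearMap (Matrix.toLin' B)) 0

end PoissonFranks

end

/-! A symplectic matrix `A` close to the identity is `exp L` with `L` small and `J * L` symmetric
(`eventually_exists_hamiltonian_log`), so `A` is the time-one map of the linear Hamiltonian flow
generated by the quadratic form `quad (J * L)`. This flow is spread along the orbit segment: with
`s` a step from `0` to `1`, take `H = y₁ + s'(x₁) · quad (J * L) ŵ` near `Γ₀`, where `ŵ = (x̂, ŷ)`.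
Then `x₁' = 1` and `ŵ' = s'(x₁) L ŵ`, so an orbit starting on `Σ₀` has `x₁ = t` and `ŵ(t) = exp
(s(t) L) w`. The form is constant along it, and conservation of energy gives `y₁ = -s'(t) quad (J *
L) ŵ`. Since `s'` vanishes at `0` and `1`, the orbit runs from `Σ₀` to `Σ₀'` in time exactly `1` and
arrives at `exp L w = A w` (`isLinearPoincareMap_exp`).

To confine the perturbation to `B_ρ`, let `s'` be supported near some `r < ρ` and multiply by a bump
`χ` equal to `1` near the part of `Γ₀` where `s'` may be nonzero. The product still equals the model
near `Γ₀`, and there it is quadratic in `ŵ`, so `X_H` is unchanged on `Γ₀`. It is a linear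
combination of finitely many fixed compactly supported functions whose coefficients are the entries
of `J * L / 2`, hence it is `C²`-small when `L` is small (`exists_normC2_sum_lt`). -/

namespace PoissonFranks

open Matrix NormedSpace

/-! ### Hamiltonian logarithms of symplectic matrices near the identity. -/

section MatrixLog

attribute [local instance] Matrix.linftyOpNormedRing Matrix.linftyOpNormedAlgebra

/-- The exponential of matrices has a local right inverse at `1` which maps symplectic matrices
to Hamiltonian ones. -/
theorem eventually_exists_hamiltonian_log {l : Type*} [Fintype l] [DecidableEq l]
    {V : Set (Matrix (l ⊕ l) (l ⊕ l) ℝ)} (hV : V ∈ 𝓝 0) :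
    ∀ᶠ A in 𝓝 (1 : Matrix (l ⊕ l) (l ⊕ l) ℝ), A ∈ symplecticGroup l ℝ →
      ∃ L ∈ V, exp L = A ∧ (J l ℝ * L)ᵀ = J l ℝ * L := by
  have hd : HasStrictFDerivAt (exp : Matrix (l ⊕ l) (l ⊕ l) ℝ → _)
      ((ContinuousLinearEquiv.refl ℝ (Matrix (l ⊕ l) (l ⊕ l) ℝ) :
        Matrix (l ⊕ l) (l ⊕ l) ℝ →L[ℝ] Matrix (l ⊕ l) (l ⊕ l) ℝ)) 0 :=
    hasStrictFDerivAt_exp_zero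
  set g := hd.localInverse exp _ 0
  have hexp0 : exp (0 : Matrix (l ⊕ l) (l ⊕ l) ℝ) = 1 := exp_zero
  have hgc : Filter.Tendsto g (𝓝 1) (𝓝 0) := by
    have := hd.localInverse_continuousAt
    rw [ContinuousAt, hd.localInverse_apply_image, hexp0] at this
    exact this
  have hr : ∀ᶠ A in 𝓝 (1 : Matrix (l ⊕ l) (l ⊕ l) ℝ), exp (g A) = A := by
    have := hd.eventually_right_inverse
    rwa [hexp0] at this
  have hl : ∀ᶠ L in 𝓝 (0 : Matrix (l ⊕ l) (l ⊕ l) ℝ), g (exp L) = L := hd.eventually_left_inverse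
  -- Both `-L` and `J⁻¹ Lᵀ J` tend to `0` with `L`, so for `A` near `1` they lie where `g` inverts
  -- `exp` on the left.
  have hneg : Filter.Tendsto (fun L : Matrix (l ⊕ l) (l ⊕ l) ℝ => -L) (𝓝 0) (𝓝 0) := by
    have h := (continuous_neg (G := Matrix (l ⊕ l) (l ⊕ l) ℝ)).tendsto 0
    rwa [neg_zero] at h
  have hconj : Filter.Tendsto (fun L : Matrix (l ⊕ l) (l ⊕ l) ℝ => (J l ℝ)⁻¹ * Lᵀ * J l ℝ)
      (𝓝 0) (𝓝 0) := by
    have hc : Continuous fun L : Matrix (l ⊕ l) (l ⊕ l) ℝ => (J l ℝ)⁻¹ * Lᵀ * J l ℝ :=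
      (continuous_const.mul (continuous_id.matrix_transpose)).mul continuous_const
    have h := hc.tendsto 0
    simpa using h
  filter_upwards [hr, hgc hV, hgc.eventually (hneg.eventually hl),
    hgc.eventually (hconj.eventually hl)] with A hA hAV h1 h2 hS
  refine ⟨g A, hAV, hA, ?_⟩
  have hdet : IsUnit (J l ℝ).det := isUnit_det_J l ℝ
  have e1 : exp (-(g A)) = A⁻¹ := by rw [Matrix.exp_neg, hA]
  have e2 : exp ((J l ℝ)⁻¹ * (g A)ᵀ * J l ℝ) = A⁻¹ := by
    rw [Matrix.exp_conj' _ _ ((Matrix.isUnit_iff_isUnit_det _).2 hdet), Matrix.exp_transpose, hA,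
      SymplecticGroup.inv_eq_symplectic_inv A hS, J_inv]
  -- Two small logarithms of the same matrix `A⁻¹` coincide; this is the infinitesimal form of the
  -- symplectic condition.
  have e3 : (J l ℝ)⁻¹ * (g A)ᵀ * J l ℝ = -(g A) := by
    rw [← h2, ← h1, e1, e2]
  have e4 : (g A)ᵀ * J l ℝ = -(J l ℝ * g A) := by
    have := congrArg (fun M => J l ℝ * M) e3
    simpa [Matrix.mul_assoc, Matrix.mul_nonsing_inv_cancel_left _ _ hdet] using this
  rw [Matrix.transpose_mul, J_transpose, Matrix.mul_neg, e4, neg_neg]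

theorem hasDerivAt_exp_smul_mulVec {m : Type*} [Fintype m] [DecidableEq m] (L : Matrix m m ℝ)
    (w : m → ℝ) {s : ℝ → ℝ} {b t : ℝ} (hs : HasDerivAt s b t) :
    HasDerivAt (fun t => exp (s t • L) *ᵥ w) (b • (L *ᵥ (exp (s t • L) *ᵥ w))) t := by
  have h := (hasDerivAt_exp_smul_const' (𝕂 := ℝ) L (s t)).scomp t hs
  have := (LinearMap.toContinuousLinearMap
    ((Matrix.mulVecBilin ℝ ℝ).flip w)).hasFDerivAt.comp_hasDerivAt t h
  have e : b • (L *ᵥ (exp (s t • L) *ᵥ w)) = (b • (L * exp (s t • L))) *ᵥ w := by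
    rw [Matrix.mulVec_mulVec, Matrix.smul_mulVec]
  rw [e]
  exact this

theorem continuous_exp_smul {m : Type*} [Fintype m] [DecidableEq m] (L : Matrix m m ℝ) :
    Continuous fun t : ℝ => exp (t • L) :=
  continuous_iff_continuousAt.2 fun t =>
    (hasDerivAt_exp_smul_const (𝕂 := ℝ) L t).continuousAt

end MatrixLog

/-- Every neighbourhood of a matrix contains a ball for `matNorm`. -/
theorem exists_matNorm_lt_of_mem_nhds {d : ℕ} {M : Matrix (Fin d ⊕ Fin d) (Fin d ⊕ Fin d) ℝ}
    {V : Set (Matrix (Fin d ⊕ Fin d) (Fin d ⊕ Fin d) ℝ)} (hV : V ∈ 𝓝 M) :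
    ∃ δ : ℝ, 0 < δ ∧ ∀ A, matNorm (A - M) < δ → A ∈ V := by
  -- The topology on matrices is the product one; viewing `V` among functions gives access to the
  -- sup metric.
  have hV' : (V : Set (Fin d ⊕ Fin d → Fin d ⊕ Fin d → ℝ)) ∈
    @nhds (Fin d ⊕ Fin d → Fin d ⊕ Fin d → ℝ) _ M := hV
  obtain ⟨δ, hδ, h⟩ := Metric.mem_nhds_iff.1 hV'
  refine ⟨δ, hδ, fun A hA => h ?_⟩
  refine (dist_pi_lt_iff hδ).2 fun i => (dist_pi_lt_iff hδ).2 fun j => lt_of_le_of_lt ?_ hA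
  calc dist (A i j) (M i j) = |(A - M) i j| := rfl
    _ ≤ ∑ i, |(A - M) i j| :=
      Finset.single_le_sum (f := fun i => |(A - M) i j|) (fun _ _ => abs_nonneg _)
        (Finset.mem_univ i)
    _ ≤ matNorm (A - M) :=
      le_ciSup (f := fun j => ∑ i, |(A - M) i j|) (Set.finite_range _).bddAbove j

/-! ### Bounds for the `C²` norm. -/

variable {d n : ℕ}

theorem contDiff_pderiv {f : Phase d n → ℝ} {m k : ℕ∞} (hf : ContDiff ℝ k f) (hk : m + 1 ≤ k)
    (c : Idx d n) : ContDiff ℝ m (pderiv c f) := by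
  unfold pderiv
  exact (hf.fderiv_right (by exact_mod_cast hk)).clm_apply contDiff_const

theorem hasCompactSupport_pderiv {f : Phase d n → ℝ} (hf : HasCompactSupport f) (c : Idx d n) :
    HasCompactSupport (pderiv c f) :=
  hf.fderiv_apply ℝ (basisVec c)

theorem pderiv_sum {κ : Type*} [Fintype κ] (a : κ → ℝ) {f : κ → Phase d n → ℝ}
    (hf : ∀ k, Differentiable ℝ (f k)) (c : Idx d n) :
    pderiv c (fun p => ∑ k, a k * f k p) = fun p => ∑ k, a k * pderiv c (f k) p := by
  ext p
  unfold pderiv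
  rw [fderiv_fun_sum fun k _ => (hf k p).const_mul (a k)]
  simp [fderiv_const_mul (hf _ p)]

theorem normC0_le {f : Phase d n → ℝ} {C : ℝ} (h : ∀ p, |f p| ≤ C) :
    normC0 f ≤ ENNReal.ofReal C :=
  iSup_le fun p => by
    rw [Real.enorm_eq_ofReal_abs]
    exact ENNReal.ofReal_le_ofReal (h p)

theorem abs_sum_mul_le {κ : Type*} [Fintype κ] {a x C : κ → ℝ} {η : ℝ}
    (ha : ∀ k, |a k| ≤ η) (hx : ∀ k, |x k| ≤ C k) : |∑ k, a k * x k| ≤ η * ∑ k, C k := by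
  rw [Finset.mul_sum]
  refine (Finset.abs_sum_le_sum_abs _ _).trans (Finset.sum_le_sum fun k _ => ?_)
  rw [abs_mul]
  exact mul_le_mul (ha k) (hx k) (abs_nonneg _) ((abs_nonneg _).trans (ha k))

/-- A smooth function with compact support is bounded along with its partial derivatives. -/
theorem exists_bound_pderiv {f : Phase d n → ℝ} (hf : ContDiff ℝ 2 f)
    (hc : HasCompactSupport f) :
    ∃ C : ℝ, (∀ p, |f p| ≤ C) ∧ (∀ c p, |pderiv c f p| ≤ C) ∧
      ∀ c c' p, |pderiv c (pderiv c' f) p| ≤ C := by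
  have h1 : ∀ c, ContDiff ℝ 1 (pderiv c f) := fun c =>
    contDiff_pderiv (m := 1) (k := 2) hf (by norm_num) c
  have h2 : ∀ c c', ContDiff ℝ 0 (pderiv c (pderiv c' f)) := fun c c' =>
    contDiff_pderiv (m := 0) (k := 1) (h1 c') (by norm_num) c
  obtain ⟨C0, hC0⟩ := hc.exists_bound_of_continuous hf.continuous
  choose C1 hC1 using fun c =>
    (hasCompactSupport_pderiv hc c).exists_bound_of_continuous (h1 c).continuous
  choose C2 hC2 using fun c c' =>
    (hasCompactSupport_pderiv (hasCompactSupport_pderiv hc c') c).exists_bound_of_continuous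
      (h2 c c').continuous
  have k0 : 0 ≤ C0 := (norm_nonneg _).trans (hC0 0)
  have k1 : ∀ c, 0 ≤ C1 c := fun c => (norm_nonneg _).trans (hC1 c 0)
  have k2 : ∀ c c', 0 ≤ C2 c c' := fun c c' => (norm_nonneg _).trans (hC2 c c' 0)
  have s1 : 0 ≤ ∑ c, C1 c := Finset.sum_nonneg fun c _ => k1 c
  have s2 : 0 ≤ ∑ c, ∑ c', C2 c c' :=
    Finset.sum_nonneg fun c _ => Finset.sum_nonneg fun c' _ => k2 c c'
  refine ⟨C0 + ∑ c, C1 c + ∑ c, ∑ c', C2 c c', fun p => ?_, fun c p => ?_, fun c c' p => ?_⟩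
  · linarith [hC0 p, Real.norm_eq_abs (f p)]
  · have := Finset.single_le_sum (fun c _ => k1 c) (Finset.mem_univ c)
    linarith [hC1 c p, Real.norm_eq_abs (pderiv c f p)]
  · have e1 := Finset.single_le_sum (fun c' _ => k2 c c') (Finset.mem_univ c')
    have e2 := Finset.single_le_sum (f := fun c => ∑ c', C2 c c')
      (fun c _ => Finset.sum_nonneg fun c' _ => k2 c c') (Finset.mem_univ c)
    have e3 := hC2 c c' p
    rw [Real.norm_eq_abs] at e3
    linarith

/-- Small linear combinations of finitely many compactly supported `C²` functions are `C²`-small. -/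
theorem exists_normC2_sum_lt {κ : Type*} [Fintype κ] {f : κ → Phase d n → ℝ}
    (hf : ∀ k, ContDiff ℝ 2 (f k)) (hc : ∀ k, HasCompactSupport (f k)) {ε : ℝ} (hε : 0 < ε) :
    ∃ η : ℝ, 0 < η ∧ ∀ a : κ → ℝ, (∀ k, |a k| ≤ η) →
      normC2 (fun p => ∑ k, a k * f k p) < ENNReal.ofReal ε := by
  choose C h0 h1 h2 using fun k => exists_bound_pderiv (hf k) (hc k)
  have hC : 0 ≤ ∑ k, C k := Finset.sum_nonneg fun k _ => (abs_nonneg _).trans (h0 k 0)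
  have hd : ∀ c k, Differentiable ℝ (pderiv c (f k)) := fun c k =>
    (contDiff_pderiv (m := 1) (k := 2) (hf k) (by norm_num) c).differentiable (by norm_num)
  -- The summand `1` keeps the denominator positive when all the bounds vanish, in particular when
  -- `κ` is empty.
  refine ⟨ε / (2 * (1 + ∑ k, C k)), by positivity, fun a ha => ?_⟩
  have hlt : ε / (2 * (1 + ∑ k, C k)) * ∑ k, C k < ε := by
    rw [div_mul_eq_mul_div, div_lt_iff₀ (by positivity)]
    nlinarith
  refine lt_of_le_of_lt ?_ ((ENNReal.ofReal_lt_ofReal_iff hε).2 hlt)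
  have hp : ∀ c, pderiv c (fun p => ∑ k, a k * f k p) = fun p => ∑ k, a k * pderiv c (f k) p :=
    pderiv_sum a fun k => (hf k).differentiable (by norm_num)
  refine max_le (normC0_le fun p => abs_sum_mul_le ha fun k => h0 k p)
    (max_le (iSup_le fun c => normC0_le fun p => ?_)
      (iSup_le fun c => iSup_le fun c' => normC0_le fun p => ?_))
  · rw [hp]
    exact abs_sum_mul_le ha fun k => h1 k c p
  · rw [hp, pderiv_sum a (hd c')]
    exact abs_sum_mul_le ha fun k => h2 k c c' p

/-! ### Coordinates and components of Hamiltonian vector fields. -/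

/-- The point with coordinates `x₁ = x`, `y₁ = y`, `(x̂, ŷ) = w` and `z = 0`. -/
def embed (n : ℕ) (x y : ℝ) (w : Trans d) : Phase d n :=
  WithLp.toLp 2 (Sum.elim
    (Sum.elim (Fin.cons x fun i => w (Sum.inl i)) (Fin.cons y fun i => w (Sum.inr i)))
    fun _ => 0)

/-- The indices of the coordinates `(x̂, ŷ)`. -/
def transIdx (n : ℕ) : Fin d ⊕ Fin d → Idx d n :=
  Sum.elim (fun i => ix i.succ) fun i => iy i.succ

/-- The coordinates `(x̂, ŷ)` of a point. -/
noncomputable def transCoord : Phase d n →L[ℝ] Trans d :=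
  ContinuousLinearMap.pi fun i => EuclideanSpace.proj (transIdx n i)

@[simp] theorem transCoord_apply (p : Phase d n) (i) : transCoord p i = p (transIdx n i) := rfl

@[simp] theorem embed_ix_zero (x y : ℝ) (w : Trans d) : embed n x y w (ix 0) = x := rfl

@[simp] theorem embed_iy_zero (x y : ℝ) (w : Trans d) : embed n x y w (iy 0) = y := rfl

@[simp] theorem embed_iz (x y : ℝ) (w : Trans d) (k) : embed n x y w (iz k) = 0 := rfl

@[simp] theorem embed_ix_succ (x y : ℝ) (w : Trans d) (i : Fin d) :
    embed n x y w (ix i.succ) = w (Sum.inl i) := rfl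

@[simp] theorem embed_iy_succ (x y : ℝ) (w : Trans d) (i : Fin d) :
    embed n x y w (iy i.succ) = w (Sum.inr i) := rfl

@[simp] theorem embed_transIdx (x y : ℝ) (w : Trans d) (i) : embed n x y w (transIdx n i) = w i := by
  rcases i with i | i <;> rfl

@[simp] theorem transCoord_embed (x y : ℝ) (w : Trans d) : transCoord (embed n x y w) = w := by
  ext i; simp

theorem sectionPt_eq_embed (s : ℝ) (w : Trans d) : sectionPt n s w = embed n s 0 w := rfl

theorem forall_idx {P : Idx d n → Prop} (hx : P (ix 0)) (hy : P (iy 0))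
    (ht : ∀ i, P (transIdx n i)) (hz : ∀ k, P (iz k)) (c : Idx d n) : P c := by
  rcases c with (i | i) | k
  · exact Fin.cases hx (fun i => ht (Sum.inl i)) i
  · exact Fin.cases hy (fun i => ht (Sum.inr i)) i
  · exact hz k

theorem eq_embed_iff {p : Phase d n} {x y : ℝ} {w : Trans d} :
    p = embed n x y w ↔
      p (ix 0) = x ∧ p (iy 0) = y ∧ (∀ i, p (transIdx n i) = w i) ∧ ∀ k, p (iz k) = 0 := by
  constructor
  · rintro rfl
    simp
  · rintro ⟨hx, hy, ht, hz⟩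
    ext c
    revert c
    exact forall_idx (by simpa) (by simpa) (fun i => by rw [ht, embed_transIdx]) (by simpa)

theorem hasDerivAt_embed {x y : ℝ → ℝ} {w : ℝ → Trans d} {x' y' t : ℝ} {w' : Trans d}
    (hx : HasDerivAt x x' t) (hy : HasDerivAt y y' t) (hw : HasDerivAt w w' t) :
    HasDerivAt (fun t => embed n (x t) (y t) (w t)) (embed n x' y' w') t := by
  rw [hasDerivAt_pi] at hw
  have h : HasDerivAt (fun t => (embed n (x t) (y t) (w t)).ofLp) (embed n x' y' w').ofLp t :=
    hasDerivAt_pi.2 (forall_idx (by simpa) (by simpa)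
      (fun i => by simpa only [embed_transIdx] using hw i) (by simp [hasDerivAt_const]))
  exact (PiLp.continuousLinearEquiv 2 ℝ fun _ : Idx d n => ℝ).symm.hasFDerivAt.comp_hasDerivAt t h

theorem hamVF_apply_ix (H : Phase d n → ℝ) (p) (i) :
    hamVF H p (ix i) = fderiv ℝ H p (basisVec (iy i)) := by
  simp [hamVF, canonicalPoisson, basisVec]

theorem hamVF_apply_iy (H : Phase d n → ℝ) (p) (i) :
    hamVF H p (iy i) = -fderiv ℝ H p (basisVec (ix i)) := by
  simp [hamVF, canonicalPoisson, basisVec]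

theorem hamVF_apply_iz (H : Phase d n → ℝ) (p) (k) : hamVF H p (iz k) = 0 := by
  simp [hamVF, canonicalPoisson, basisVec]

/-! ### The model perturbation and its vector field. -/

/-- The quadratic form `w ↦ ½ ⟨w, S w⟩`. -/
noncomputable def quad (S : Matrix (Fin d ⊕ Fin d) (Fin d ⊕ Fin d) ℝ) (w : Trans d) : ℝ :=
  ∑ k : (Fin d ⊕ Fin d) × (Fin d ⊕ Fin d), S k.1 k.2 / 2 * (w k.1 * w k.2)

@[simp] theorem quad_zero (S : Matrix (Fin d ⊕ Fin d) (Fin d ⊕ Fin d) ℝ) : quad S 0 = 0 := by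
  simp [quad]

theorem hasFDerivAt_quad {S : Matrix (Fin d ⊕ Fin d) (Fin d ⊕ Fin d) ℝ} (hS : Sᵀ = S)
    (w : Trans d) :
    HasFDerivAt (quad S) (∑ i, (S *ᵥ w) i • ContinuousLinearMap.proj (R := ℝ) (φ := fun _ => ℝ) i) w := by
  have h : HasFDerivAt (quad S) _ w := HasFDerivAt.fun_sum fun k _ =>
    (((ContinuousLinearMap.proj (R := ℝ) (φ := fun _ : Fin d ⊕ Fin d => ℝ) k.1).hasFDerivAt.mul
      (ContinuousLinearMap.proj (R := ℝ) (φ := fun _ : Fin d ⊕ Fin d => ℝ)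
        k.2).hasFDerivAt).const_mul (S k.1 k.2 / 2))
  refine h.congr_fderiv (ContinuousLinearMap.ext fun v => ?_)
  have hS' : ∀ i j, S i j = S j i := fun i j => congrFun (congrFun hS j) i
  simp only [_root_.sum_apply, _root_.smul_apply,
    ContinuousLinearMap.proj_apply, _root_.add_apply, smul_eq_mul, Fintype.sum_prod_type,
    mul_add, Finset.sum_add_distrib, mulVec, dotProduct, Finset.sum_mul]
  -- The product rule gives two halves; exchanging the indices in one of them and using the symmetry
  -- of `S` makes them equal.
  rw [Finset.sum_comm (f := fun i j => S i j / 2 * (w i * v j)),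
    ← Finset.sum_add_distrib]
  refine Finset.sum_congr rfl fun i _ => ?_
  rw [← Finset.sum_add_distrib]
  refine Finset.sum_congr rfl fun j _ => ?_
  rw [hS' j i]
  ring

/-- The model perturbation `b(x₁) ½ ⟨ŵ, S ŵ⟩`. -/
noncomputable def model (b : ℝ → ℝ) (S : Matrix (Fin d ⊕ Fin d) (Fin d ⊕ Fin d) ℝ) (p : Phase d n) : ℝ :=
  b (p (ix 0)) * quad S (transCoord p)

theorem hasFDerivAt_H₀ (p : Phase d n) :
    HasFDerivAt H₀ (EuclideanSpace.proj (𝕜 := ℝ) (iy 0 : Idx d n)) p :=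
  (EuclideanSpace.proj (𝕜 := ℝ) (iy 0 : Idx d n)).hasFDerivAt

theorem hamVF_H₀ (p : Phase d n) : hamVF H₀ p = embed n 1 0 0 := by
  refine eq_embed_iff.2 ⟨?_, ?_, ?_, hamVF_apply_iz _ _⟩
  · simp [hamVF_apply_ix, (hasFDerivAt_H₀ p).fderiv, basisVec]
  · simp [hamVF_apply_iy, (hasFDerivAt_H₀ p).fderiv, basisVec]
  · rintro (i | i)
    · simp [transIdx, hamVF_apply_ix, (hasFDerivAt_H₀ p).fderiv, basisVec, (Fin.succ_ne_zero i).symm]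
    · simp [transIdx, hamVF_apply_iy, (hasFDerivAt_H₀ p).fderiv, basisVec]

section model

variable {S L : Matrix (Fin d ⊕ Fin d) (Fin d ⊕ Fin d) ℝ} {b : ℝ → ℝ} {b' : ℝ} {p : Phase d n}
  {f : Phase d n → ℝ}

theorem fderiv_add_of_eventuallyEq_model (hS : Sᵀ = S) (hb : HasDerivAt b b' (p (ix 0)))
    (hf : f =ᶠ[𝓝 p] model b S) (v : Phase d n) :
    fderiv ℝ (fun q => H₀ q + f q) p v = v (iy 0) + (b' * quad S (transCoord p) * v (ix 0) +
      b (p (ix 0)) * ∑ i, (S *ᵥ transCoord p) i * v (transIdx n i)) := by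
  have h1 : HasFDerivAt (fun q : Phase d n => b (q (ix 0))) _ p :=
    hb.comp_hasFDerivAt p (EuclideanSpace.proj (𝕜 := ℝ) (ix 0 : Idx d n)).hasFDerivAt
  have h2 : HasFDerivAt (fun q : Phase d n => quad S (transCoord q)) _ p :=
    (hasFDerivAt_quad hS (transCoord p)).comp p transCoord.hasFDerivAt
  rw [((hasFDerivAt_H₀ p).fun_add ((h1.mul h2).congr_of_eventuallyEq hf)).fderiv]
  simp
  ring

theorem J_mulVec_inl (u : Trans d) (i) : (J (Fin d) ℝ *ᵥ u) (Sum.inl i) = -u (Sum.inr i) := by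
  simp [J, fromBlocks_mulVec, neg_mulVec]

theorem J_mulVec_inr (u : Trans d) (i) : (J (Fin d) ℝ *ᵥ u) (Sum.inr i) = u (Sum.inl i) := by
  simp [J, fromBlocks_mulVec]

theorem dotProduct_J_mulVec_self (u : Trans d) : u ⬝ᵥ (J (Fin d) ℝ *ᵥ u) = 0 := by
  simp only [dotProduct, Fintype.sum_sum_type, J_mulVec_inl, J_mulVec_inr]
  rw [← Finset.sum_add_distrib]
  exact Finset.sum_eq_zero fun i _ => by ring

/-- Where the perturbation agrees with the model, the Hamiltonian vector field is explicit. -/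
theorem hamVF_add_of_eventuallyEq_model (hL : (J (Fin d) ℝ * L)ᵀ = J (Fin d) ℝ * L)
    (hb : HasDerivAt b b' (p (ix 0))) (hf : f =ᶠ[𝓝 p] model b (J (Fin d) ℝ * L)) :
    hamVF (fun q => H₀ q + f q) p = embed n 1 (-(b' * quad (J (Fin d) ℝ * L) (transCoord p)))
      (b (p (ix 0)) • (L *ᵥ transCoord p)) := by
  have hbv : ∀ c c' : Idx d n, (basisVec c : Phase d n) c' = if c' = c then 1 else 0 := fun c c' => by
    simp [basisVec]
  refine eq_embed_iff.2 ⟨?_, ?_, ?_, hamVF_apply_iz _ _⟩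
  · rw [hamVF_apply_ix, fderiv_add_of_eventuallyEq_model hL hb hf]
    simp [hbv, transIdx, (Fin.succ_ne_zero _)]
  · rw [hamVF_apply_iy, fderiv_add_of_eventuallyEq_model hL hb hf]
    simp [hbv, transIdx, (Fin.succ_ne_zero _)]
  · rintro (i | i)
    · change hamVF _ p (ix i.succ) = _
      rw [hamVF_apply_ix, fderiv_add_of_eventuallyEq_model hL hb hf]
      simp [hbv, transIdx, (Fin.succ_ne_zero _).symm, ← mulVec_mulVec, J_mulVec_inr]
    · change hamVF _ p (iy i.succ) = _
      rw [hamVF_apply_iy, fderiv_add_of_eventuallyEq_model hL hb hf]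
      simp [hbv, transIdx, (Fin.succ_ne_zero _).symm, ← mulVec_mulVec, J_mulVec_inl]

end model

theorem hamVF_H₀_add {f : Phase d n → ℝ} {p : Phase d n} (hf : DifferentiableAt ℝ f p) :
    hamVF (fun q => H₀ q + f q) p = hamVF H₀ p + hamVF f p := by
  ext c
  have h := fderiv_fun_add (hasFDerivAt_H₀ p).differentiableAt hf
  rcases c with (i | i) | k
  · rw [PiLp.add_apply, hamVF_apply_ix, hamVF_apply_ix, hamVF_apply_ix, h]; rfl
  · rw [PiLp.add_apply, hamVF_apply_iy, hamVF_apply_iy, hamVF_apply_iy, h]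
    simp [add_comm]
  · simp [hamVF_apply_iz]

/-- The field is the constant `∂/∂x₁` plus a compactly supported `C¹` field. The global Lipschitz
constant gives uniqueness of orbits, needed for the minimality of the return time. -/
theorem exists_lipschitzWith_hamVF {f : Phase d n → ℝ} (hf : ContDiff ℝ 2 f)
    (hc : HasCompactSupport f) : ∃ K, LipschitzWith K (hamVF fun q => H₀ q + f q) := by
  have h1 : ContDiff ℝ 1 (hamVF f) := by
    have hf' : ContDiff ℝ 1 (fderiv ℝ f) := hf.fderiv_right (by norm_num)
    refine contDiff_euclidean.2 fun c => ?_
    unfold hamVF canonicalPoisson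
    fun_prop
  have h2 : HasCompactSupport (hamVF f) :=
    (hc.fderiv (𝕜 := ℝ)).comp_left
      (g := fun ξ => WithLp.toLp 2 fun c => canonicalPoisson (EuclideanSpace.proj c) ξ)
      (by ext; simp [canonicalPoisson])
  obtain ⟨K, hK⟩ := ContDiff.lipschitzWith_of_hasCompactSupport h2 h1 (by norm_num)
  refine ⟨0 + K, ?_⟩
  have : (hamVF fun q => H₀ q + f q) = fun p => embed n 1 0 0 + hamVF f p := by
    ext1 p
    rw [hamVF_H₀_add (hf.differentiable (by norm_num) p), hamVF_H₀]
  rw [this]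
  exact (LipschitzWith.const _).add hK

theorem continuous_embed : Continuous fun q : ℝ × ℝ × Trans d => embed n q.1 q.2.1 q.2.2 := by
  refine (PiLp.continuous_toLp 2 _).comp (continuous_pi (forall_idx ?_ ?_ ?_ ?_))
  · exact continuous_fst
  · exact continuous_fst.comp continuous_snd
  · rintro (i | i)
    · exact (continuous_apply (Sum.inl i)).comp (continuous_snd.comp continuous_snd)
    · exact (continuous_apply (Sum.inr i)).comp (continuous_snd.comp continuous_snd)
  · exact fun k => continuous_const

/-! ### Sections, orbit segment and tangent spaces. -/

theorem mem_section₀_iff {p : Phase d n} {s : ℝ} :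
    p ∈ section₀ d n s ↔ ∃ w, p = embed n s 0 w := by
  constructor
  · rintro ⟨hx, hy, hz⟩
    exact ⟨transCoord p, eq_embed_iff.2 ⟨hx, hy, fun _ => rfl, hz⟩⟩
  · rintro ⟨w, rfl⟩
    exact ⟨rfl, rfl, fun _ => rfl⟩

theorem mem_Γ₀_iff {p : Phase d n} : p ∈ Γ₀ d n ↔ ∃ t ∈ Set.Icc (0 : ℝ) 1, p = embed n t 0 0 := by
  constructor
  · rintro ⟨hx, h⟩
    refine ⟨_, hx, eq_embed_iff.2 ⟨rfl, h _ (by simp), ?_, fun k => h _ (by simp)⟩⟩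
    rintro (i | i) <;> exact h _ (by simp [transIdx])
  · rintro ⟨t, ht, rfl⟩
    exact ⟨ht, forall_idx (by simp) (by simp) (by simp) (by simp)⟩

theorem convex_section₀ (s : ℝ) : Convex ℝ (section₀ d n s) := by
  rintro p ⟨hx, hy, hz⟩ q ⟨hx', hy', hz'⟩ a b - - hab
  refine ⟨?_, ?_, fun k => ?_⟩
  · simp [hx, hx', ← add_mul, hab]
  · simp [hy, hy']
  · simp [hz, hz']

theorem mem_leafTangent_iff {v : Phase d n} : v ∈ leafTangent d n ↔ ∀ k, v (iz k) = 0 := by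
  constructor
  · intro hv
    have : leafTangent d n ≤ ⨅ k, LinearMap.ker
        (EuclideanSpace.proj (𝕜 := ℝ) (iz k : Idx d n)).toLinearMap := by
      refine le_iInf fun k => sup_le ?_ ?_ <;> rw [Submodule.span_le] <;> rintro _ ⟨i, rfl⟩ <;>
        simp [basisVec]
    simpa using this hv
  · intro hv
    have : v = ∑ i : Fin (d + 1), v (ix i) • basisVec (ix i) +
        ∑ i : Fin (d + 1), v (iy i) • basisVec (iy i) := by
      ext c
      rcases c with (i | i) | k <;> simp [basisVec, Pi.single_apply, hv]
    rw [this]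
    exact Submodule.add_mem_sup
      (Submodule.sum_mem _ fun i _ => Submodule.smul_mem _ _ (Submodule.subset_span ⟨i, rfl⟩))
      (Submodule.sum_mem _ fun i _ => Submodule.smul_mem _ _ (Submodule.subset_span ⟨i, rfl⟩))

theorem mem_sectionTangent_iff {v : Phase d n} :
    v ∈ sectionTangent d n ↔ v (ix 0) = 0 ∧ v (iy 0) = 0 ∧ ∀ k, v (iz k) = 0 := by
  constructor
  · intro hv
    have : sectionTangent d n ≤
        LinearMap.ker (EuclideanSpace.proj (𝕜 := ℝ) (ix 0 : Idx d n)).toLinearMap ⊓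
        (LinearMap.ker (EuclideanSpace.proj (𝕜 := ℝ) (iy 0 : Idx d n)).toLinearMap ⊓
        ⨅ k, LinearMap.ker (EuclideanSpace.proj (𝕜 := ℝ) (iz k : Idx d n)).toLinearMap) := by
      refine sup_le ?_ ?_ <;> rw [Submodule.span_le] <;> rintro _ ⟨i, rfl⟩ <;>
        simp [basisVec, (Fin.succ_ne_zero i).symm]
    simpa using this hv
  · rintro ⟨hx, hy, hz⟩
    have : v = ∑ i : Fin d, v (ix i.succ) • basisVec (ix i.succ) +
        ∑ i : Fin d, v (iy i.succ) • basisVec (iy i.succ) := by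
      ext c
      rcases c with (i | i) | k
      · refine Fin.cases ?_ (fun i => ?_) i <;>
          simp [basisVec, Pi.single_apply, hx, (Fin.succ_ne_zero _).symm]
      · refine Fin.cases ?_ (fun i => ?_) i <;>
          simp [basisVec, Pi.single_apply, hy, (Fin.succ_ne_zero _).symm]
      · simp [basisVec, hz]
    rw [this]
    exact Submodule.add_mem_sup
      (Submodule.sum_mem _ fun i _ => Submodule.smul_mem _ _ (Submodule.subset_span ⟨i, rfl⟩))
      (Submodule.sum_mem _ fun i _ => Submodule.smul_mem _ _ (Submodule.subset_span ⟨i, rfl⟩))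

/-! ### Transversality of the sections. -/

variable {S L : Matrix (Fin d ⊕ Fin d) (Fin d ⊕ Fin d) ℝ} {b : ℝ → ℝ} {f : Phase d n → ℝ}

theorem model_embed (x y : ℝ) (w : Trans d) : model b S (embed n x y w) = b x * quad S w := by
  simp [model]

/-- Where the perturbation agrees with a model that vanishes on the section, the section is a
transversal. -/
theorem isTransversal_of_eventuallyEq_model (hL : (J (Fin d) ℝ * L)ᵀ = J (Fin d) ℝ * L) {s : ℝ}
    (hb : DifferentiableAt ℝ b s) (hb0 : b s = 0)
    (hf : f =ᶠ[𝓝 (embed n s 0 0)] model b (J (Fin d) ℝ * L)) :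
    IsTransversal (fun q => H₀ q + f q) s := by
  -- At the base point `ŵ = 0`, so the quadratic form and its differential vanish: `X_H = ∂/∂x₁` and
  -- `dH = dy₁`.
  have hv : hamVF (fun q => H₀ q + f q) (sectionPt n s 0) = embed n 1 0 0 := by
    rw [sectionPt_eq_embed, hamVF_add_of_eventuallyEq_model hL (b' := deriv b s) hb.hasDerivAt hf]
    simp
  have hd : ∀ v, fderiv ℝ (fun q => H₀ q + f q) (sectionPt n s 0) v = v (iy 0) := fun v => by
    rw [sectionPt_eq_embed, fderiv_add_of_eventuallyEq_model hL (b' := deriv b s) hb.hasDerivAt hf]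
    simp
  refine ⟨?_, ?_, ?_⟩
  -- On the section inside a small ball `y₁ = 0` and `b = 0`, so `H = 0`; this piece is convex,
  -- hence lies in a single component of the level set.
  · obtain ⟨r, hr, hball⟩ := Metric.eventually_nhds_iff_ball.1 hf
    have hsub : section₀ d n s ∩ Metric.ball (sectionPt n s 0) r ⊆
        {q | H₀ q + f q =
          H₀ (sectionPt n s (0 : Trans d)) + f (sectionPt n s 0)} := by
      have key : ∀ q ∈ section₀ d n s ∩ Metric.ball (sectionPt n s 0) r, H₀ q + f q = 0 := by
        rintro q ⟨hq, hqr⟩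
        rw [hball q hqr]
        obtain ⟨w, rfl⟩ := mem_section₀_iff.1 hq
        simp [model_embed, hb0, H₀]
      exact fun q hq => (key q hq).trans
        (key (sectionPt n s 0) ⟨mem_section₀_iff.2 ⟨0, rfl⟩, Metric.mem_ball_self hr⟩).symm
    filter_upwards [self_mem_nhdsWithin,
      mem_nhdsWithin_of_mem_nhds (Metric.ball_mem_nhds (sectionPt n s 0) hr)] with q hq hqr
    refine ⟨?_, fun k => hq.2.2 k⟩
    exact IsPreconnected.subset_connectedComponentIn
      ((convex_section₀ s).inter (convex_ball _ _)).isPreconnected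
      ⟨mem_section₀_iff.2 ⟨0, rfl⟩, Metric.mem_ball_self hr⟩ hsub ⟨hq, hqr⟩
  · ext v
    rw [hv, Submodule.mem_inf, mem_leafTangent_iff, LinearMap.mem_ker, Submodule.mem_sup]
    change fderiv ℝ _ _ v = 0 ∧ _ ↔ _
    rw [hd]
    constructor
    · rintro ⟨hy, hz⟩
      refine ⟨v - v (ix 0) • embed n 1 0 0, mem_sectionTangent_iff.2 ⟨?_, ?_, ?_⟩,
        v (ix 0) • embed n 1 0 0, Submodule.smul_mem _ _ (Submodule.mem_span_singleton_self _),
        sub_add_cancel _ _⟩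
      · simp
      · simp [hy]
      · simp [hz]
    · rintro ⟨u, hu, u', hu', rfl⟩
      obtain ⟨a, rfl⟩ := Submodule.mem_span_singleton.1 hu'
      obtain ⟨hx, hy, hz⟩ := mem_sectionTangent_iff.1 hu
      simp [hy, hz]
  · rw [hv, Submodule.disjoint_def]
    intro v h1 h2
    obtain ⟨a, rfl⟩ := Submodule.mem_span_singleton.1 h2
    have : a = 0 := by simpa using (mem_sectionTangent_iff.1 h1).1
    simp [this]

/-! ### The explicit orbits and the Poincaré map. -/

/-- The explicit solution of the model system. -/
noncomputable def modelCurve (n : ℕ) (s : ℝ → ℝ) (L : Matrix (Fin d ⊕ Fin d) (Fin d ⊕ Fin d) ℝ) (w : Trans d)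
    (t : ℝ) : Phase d n :=
  -- The `y₁` entry is forced by conservation of energy: it makes `y₁ + s'(t) quad (J * L) ŵ`
  -- vanish.
  embed n t (-(deriv s t * quad (J (Fin d) ℝ * L) (exp (s t • L) *ᵥ w))) (exp (s t • L) *ᵥ w)

theorem continuous_quad : Continuous (quad S) := by
  unfold quad
  fun_prop

variable {s : ℝ → ℝ}

theorem continuous_modelCurve (hs : ContDiff ℝ 2 s) :
    Continuous fun q : Trans d × ℝ => modelCurve n s L q.1 q.2 := by
  have h1 : Continuous (deriv s) := hs.continuous_deriv (by norm_num)
  have h2 : Continuous fun q : Trans d × ℝ => exp (s q.2 • L) *ᵥ q.1 := by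
    have h : Continuous fun t : ℝ => exp (s t • L) :=
      (continuous_exp_smul L).comp hs.continuous
    exact (h.comp continuous_snd).matrix_mulVec continuous_fst
  exact continuous_embed.comp (continuous_snd.prodMk
    (((h1.comp continuous_snd).mul (continuous_quad.comp h2)).neg.prodMk h2))

theorem hasDerivAt_modelCurve (hL : (J (Fin d) ℝ * L)ᵀ = J (Fin d) ℝ * L) (hs : ContDiff ℝ 2 s)
    {w : Trans d} {t : ℝ}
    (hf : f =ᶠ[𝓝 (modelCurve n s L w t)] model (deriv s) (J (Fin d) ℝ * L)) :
    HasDerivAt (modelCurve n s L w) (hamVF (fun q => H₀ q + f q) (modelCurve n s L w t)) t := by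
  have hs' : HasDerivAt (deriv s) (deriv (deriv s) t) t :=
    ((hs.deriv' : ContDiff ℝ 1 (deriv s)).differentiable (by norm_num) t).hasDerivAt
  have hw := hasDerivAt_exp_smul_mulVec L w (hs.differentiable (by norm_num) t).hasDerivAt
  -- The form is a first integral of its own linear flow: its derivative is `s'(t) ⟨J u, u⟩` with `u
  -- = L ŵ`, and `J` is antisymmetric.
  have hq : HasDerivAt (fun t => quad (J (Fin d) ℝ * L) (exp (s t • L) *ᵥ w)) 0 t := by
    refine ((hasFDerivAt_quad hL _).comp_hasDerivAt t hw).congr_deriv ?_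
    have := dotProduct_J_mulVec_self (L *ᵥ (exp (s t • L) *ᵥ w))
    rw [dotProduct] at this
    simp only [_root_.sum_apply, _root_.smul_apply,
      ContinuousLinearMap.proj_apply, Pi.smul_apply, smul_eq_mul, ← mulVec_mulVec]
    rw [← mul_zero (deriv s t), ← this, Finset.mul_sum]
    exact Finset.sum_congr rfl fun i _ => by ring
  have h : HasDerivAt (modelCurve n s L w) _ t := hasDerivAt_embed (hasDerivAt_id t) (hs'.mul hq).neg hw
  rw [hamVF_add_of_eventuallyEq_model hL hs' hf]
  exact h.congr_deriv (by simp [modelCurve])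

/-- If the perturbation agrees with the model along `Γ₀`, the linear Poincaré map is `exp L`. -/
theorem isLinearPoincareMap_exp (hL : (J (Fin d) ℝ * L)ᵀ = J (Fin d) ℝ * L)
    (hA : exp L ∈ symplecticGroup (Fin d) ℝ) (hs : ContDiff ℝ 2 s) (hs0 : s 0 = 0) (hs1 : s 1 = 1)
    (hd0 : deriv s 0 = 0) (hd1 : deriv s 1 = 0) (hf2 : ContDiff ℝ 2 f) (hc : HasCompactSupport f)
    (hf : ∀ t ∈ Set.Icc (0 : ℝ) 1,
      f =ᶠ[𝓝 (embed n t 0 0)] model (deriv s) (J (Fin d) ℝ * L)) :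
    IsLinearPoincareMap (fun q => H₀ q + f q) (exp L) := by
  have hdiff : Differentiable ℝ (deriv s) :=
    (hs.deriv' : ContDiff ℝ 1 (deriv s)).differentiable (by norm_num)
  have hcurve0 : ∀ w, modelCurve n s L w 0 = sectionPt n 0 w := fun w => by
    simp [modelCurve, hs0, hd0, sectionPt_eq_embed]
  have hcurve1 : ∀ w, modelCurve n s L w 1 = sectionPt n 1 (exp L *ᵥ w) := fun w => by
    simp [modelCurve, hs1, hd1, sectionPt_eq_embed]
  -- The curve with `w = 0` is `Γ₀`. Compactness of `[0, 1]` gives one neighbourhood of starting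
  -- points whose curves all stay where the perturbation is the model.
  have hnear : ∀ᶠ w in 𝓝 (0 : Trans d), ∀ t ∈ Set.Icc (0 : ℝ) 1,
      f =ᶠ[𝓝 (modelCurve n s L w t)] model (deriv s) (J (Fin d) ℝ * L) := by
    refine isCompact_Icc.eventually_forall_of_forall_eventually fun t ht => ?_
    have h := (continuous_modelCurve (n := n) (L := L) hs).tendsto (0, t)
    have h0 : modelCurve n s L 0 t = embed n t 0 0 := by simp [modelCurve]
    rw [h0] at h
    exact h.eventually (hf t ht).eventually_nhds
  obtain ⟨U, hU, hUo, h0U⟩ := eventually_nhds_iff.1 hnear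
  obtain ⟨K, hK⟩ := exists_lipschitzWith_hamVF hf2 hc
  have hcd : ∀ w ∈ U, ∀ t ∈ Set.Icc (0 : ℝ) 1, HasDerivAt (modelCurve n s L w)
      (hamVF (fun q => H₀ q + f q) (modelCurve n s L w t)) t :=
    fun w hw t ht => hasDerivAt_modelCurve hL hs (hU w hw t ht)
  have hflow : ∀ w ∈ U, FlowsTo (fun q => H₀ q + f q) 1 (sectionPt n 0 w)
      (sectionPt n 1 (exp L *ᵥ w)) := fun w hw =>
    ⟨zero_le_one, modelCurve n s L w, hcurve0 w, hcurve1 w,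
      fun t ht => (hcd w hw t ht).hasDerivWithinAt⟩
  have hP : HasFDerivAt (fun w : Trans d => exp L *ᵥ w) _ 0 :=
    (LinearMap.toContinuousLinearMap (Matrix.toLin' (exp L))).hasFDerivAt
  -- Since `x₁ = t` along the curves, the return time is constantly `1`, and the Poincaré map is
  -- linear.
  refine ⟨U, fun _ => 1, fun w => exp L *ᵥ w, ?_, hP⟩
  refine
    { isOpen := hUo
      zero_mem := h0U
      transversal_start :=
        isTransversal_of_eventuallyEq_model hL (hdiff 0) hd0 (hf 0 (by simp))
      transversal_end :=
        isTransversal_of_eventuallyEq_model hL (hdiff 1) hd1 (hf 1 (by simp))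
      time_isLeast := fun w hw => ⟨⟨_, mem_section₀_iff.2 ⟨_, rfl⟩, hflow w hw⟩, ?_⟩
      flowsTo := hflow
      map_zero := by simp
      time_contDiffOn := contDiffOn_const
      time_bounded := ⟨1, fun _ _ => le_rfl⟩
      contDiffOn :=
        (LinearMap.toContinuousLinearMap (Matrix.toLin' (exp L))).contDiff.contDiffOn
      injOn := fun w _ w' _ h => ?_
      symplectic := fun w _ => ?_ }
  · rintro t ⟨q, hq, ht0, γ, hγ0, hγt, hγ⟩
    by_contra! hlt
    -- By uniqueness an orbit meeting `Σ₀'` at a time `t < 1` would be the model curve, but there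
    -- `x₁ = t ≠ 1`.
    have heq : Set.EqOn γ (modelCurve n s L w) (Set.Icc 0 t) := by
      refine ODE_solution_unique (v := fun _ => hamVF fun q => H₀ q + f q) (fun _ => hK)
        (fun u hu => (hγ u hu).continuousWithinAt) (fun u hu => ?_)
        (fun u hu => (hcd w hw u ⟨hu.1, hu.2.trans hlt.le⟩).continuousAt.continuousWithinAt)
        (fun u hu => (hcd w hw u ⟨hu.1, hu.2.le.trans hlt.le⟩).hasDerivWithinAt) ?_
      · exact (hγ u ⟨hu.1, hu.2.le⟩).mono_of_mem_nhdsWithin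
          (Filter.mem_of_superset (Icc_mem_nhdsGE hu.2) (Set.Icc_subset_Icc_left hu.1))
      · rw [hγ0, hcurve0]
    have h1 := heq ⟨ht0, le_rfl⟩
    rw [hγt] at h1
    have h2 := hq.1
    rw [h1, modelCurve, embed_ix_zero] at h2
    exact hlt.ne h2
  · exact Matrix.mulVec_injective_of_isUnit
      ((Matrix.isUnit_iff_isUnit_det _).2 (SymplecticGroup.symplectic_det hA)) h
  · have : fderiv ℝ (fun w : Trans d => exp L *ᵥ w) w =
        LinearMap.toContinuousLinearMap (Matrix.toLin' (exp L)) :=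
      (LinearMap.toContinuousLinearMap (Matrix.toLin' (exp L))).hasFDerivAt.fderiv
    rw [this]
    simpa using hA

/-! ### Cut-offs and the choice of constants. -/

/-- A smooth step from `0` to `1` whose derivative is supported in `[a, b]`. -/
theorem exists_smooth_step {a b : ℝ} (hab : a < b) :
    ∃ s : ℝ → ℝ, ContDiff ℝ 3 s ∧ (∀ t < a, s t = 0) ∧ (∀ t > b, s t = 1) ∧
      (∀ t < a, deriv s t = 0) ∧ ∀ t > b, deriv s t = 0 := by
  have hba : 0 < b - a := sub_pos.2 hab
  set s : ℝ → ℝ := fun t => Real.smoothTransition ((t - a) / (b - a))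
  have h0 : ∀ t < a, s t = 0 := fun t ht =>
    Real.smoothTransition.zero_of_nonpos (div_nonpos_of_nonpos_of_nonneg (by linarith) hba.le)
  have h1 : ∀ t > b, s t = 1 := fun t ht =>
    Real.smoothTransition.one_of_one_le ((one_le_div hba).2 (by linarith))
  refine ⟨s, ?_, h0, h1, fun t ht => ?_, fun t ht => ?_⟩
  · exact (Real.smoothTransition.contDiff (n := 3)).comp
      ((contDiff_id.sub contDiff_const).div_const _)
  · have : s =ᶠ[𝓝 t] fun _ => 0 := (eventually_lt_nhds ht).mono h0
    rw [this.deriv_eq, deriv_const]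
  · have : s =ᶠ[𝓝 t] fun _ => 1 := (eventually_gt_nhds ht).mono h1
    rw [this.deriv_eq, deriv_const]

theorem dist_embed (x x' : ℝ) :
    dist (embed n x 0 (0 : Trans d)) (embed n x' 0 0) = |x - x'| := by
  have h : embed n x 0 (0 : Trans d) - embed n x' 0 0 = EuclideanSpace.single (ix 0) (x - x') := by
    ext c
    revert c
    refine forall_idx (by simp) (by simp) ?_ (by simp)
    rintro (i | i) <;> simp [transIdx]
  rw [dist_eq_norm, h, PiLp.norm_single, Real.norm_eq_abs]

theorem hamVF_congr {f g : Phase d n → ℝ} {p : Phase d n} (h : f =ᶠ[𝓝 p] g) :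
    hamVF f p = hamVF g p := by
  unfold hamVF
  rw [h.fderiv_eq]

end PoissonFranks

open PoissonFranks in
theorem mainTheorem4 (d n : ℕ) (ρ : ℝ) (hρ : 0 < ρ) (ε : ℝ) (hε : 0 < ε) :
    ∃ δ : ℝ, 0 < δ ∧
      {A : Matrix (Fin d ⊕ Fin d) (Fin d ⊕ Fin d) ℝ |
          A ∈ Matrix.symplecticGroup (Fin d) ℝ ∧ PoissonFranks.matNorm (A - 1) < δ} ⊆
        {B : Matrix (Fin d ⊕ Fin d) (Fin d ⊕ Fin d) ℝ |
          ∃ H ∈ PoissonFranks.hamBall (d := d) (n := n) ε PoissonFranks.H₀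
              ((Metric.ball (0 : PoissonFranks.Phase d n) ρ)ᶜ ∪ PoissonFranks.Γ₀ d n),
            PoissonFranks.IsLinearPoincareMap H B} := by
  -- With `2r ≤ ρ` and `2r ≤ 1`, the interval `[3r/4, 5r/4]` carrying `s'` lies in `(0, 1)`, and the
  -- ball of radius `3r/4` about `(r, 0, …, 0)` lies in `B_ρ`.
  obtain ⟨r, hr, hrρ, hr1⟩ : ∃ r : ℝ, 0 < r ∧ 2 * r ≤ ρ ∧ 2 * r ≤ 1 :=
    ⟨min ρ 1 / 2, by positivity, by linarith [min_le_left ρ 1], by linarith [min_le_right ρ 1]⟩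
  obtain ⟨s, hs, hs0, hs1, hsd0, hsd1⟩ := exists_smooth_step (a := 3 * r / 4) (b := 5 * r / 4)
    (by linarith)
  -- The inner radius `r/2` exceeds `r/4`, so `χ = 1` near every point of the `x₁`-axis with `x₁` in
  -- `[3r/4, 5r/4]`.
  let χ : ContDiffBump (embed n r 0 (0 : Trans d)) := ⟨r / 2, 3 * r / 4, by linarith, by linarith⟩
  -- The Hamiltonian contains `s'` as a coefficient, so `s` must be `C³` for it to be `C²`.
  have hds : ContDiff ℝ 2 (deriv s) := hs.deriv'
  -- These functions do not depend on `A`, so `η`, and then `δ`, can be fixed before `A` is given.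
  let g : (Fin d ⊕ Fin d) × (Fin d ⊕ Fin d) → Phase d n → ℝ := fun k p =>
    p (transIdx n k.1) * p (transIdx n k.2) * deriv s (p (ix 0)) * χ p
  have hproj : ∀ c : Idx d n, ContDiff ℝ 2 fun p : Phase d n => p c := fun c =>
    (EuclideanSpace.proj (𝕜 := ℝ) c).contDiff
  have hg : ∀ k, ContDiff ℝ 2 (g k) := fun k =>
    (((hproj _).mul (hproj _)).mul (hds.comp (hproj _))).mul χ.contDiff
  have hgc : ∀ k, HasCompactSupport (g k) := fun k => χ.hasCompactSupport.mul_left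
  obtain ⟨η, hη, hnorm⟩ := exists_normC2_sum_lt hg hgc hε
  have hV : {L : Matrix (Fin d ⊕ Fin d) (Fin d ⊕ Fin d) ℝ |
      ∀ k : (Fin d ⊕ Fin d) × (Fin d ⊕ Fin d), |(Matrix.J (Fin d) ℝ * L) k.1 k.2 / 2| ≤ η}
      ∈ 𝓝 0 := by
    refine Filter.eventually_all.2 fun k => ?_
    have hc : Continuous fun L : Matrix (Fin d ⊕ Fin d) (Fin d ⊕ Fin d) ℝ =>
        |(Matrix.J (Fin d) ℝ * L) k.1 k.2 / 2| :=
      (((continuous_const.matrix_mul continuous_id).matrix_elem k.1 k.2).div_const 2).abs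
    have h := hc.tendsto 0
    simp only [mul_zero, Matrix.zero_apply, zero_div, abs_zero] at h
    exact (h.eventually (eventually_lt_nhds hη)).mono fun _ h => h.le
  obtain ⟨δ, hδ, hlog⟩ := exists_matNorm_lt_of_mem_nhds (eventually_exists_hamiltonian_log hV)
  refine ⟨δ, hδ, fun A ⟨hA, hAδ⟩ => ?_⟩
  obtain ⟨L, hLη, rfl, hL⟩ := hlog A hAδ hA
  let f : Phase d n → ℝ := fun p => ∑ k, (Matrix.J (Fin d) ℝ * L) k.1 k.2 / 2 * g k p
  have hfg : ∀ p, f p = model (deriv s) (Matrix.J (Fin d) ℝ * L) p * χ p := fun p => by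
    simp only [f, g, model, quad, Finset.mul_sum, Finset.sum_mul, transCoord_apply]
    exact Finset.sum_congr rfl fun k _ => by ring
  have hf : ContDiff ℝ 2 f := ContDiff.sum fun k _ => contDiff_const.mul (hg k)
  have hfc : HasCompactSupport f := by
    have : f = fun p => model (deriv s) (Matrix.J (Fin d) ℝ * L) p * χ p := funext hfg
    rw [this]
    exact χ.hasCompactSupport.mul_left
  -- Near each point of the axis either `χ = 1`, or `s'` vanishes and both sides are zero.
  have hmodel : ∀ t, f =ᶠ[𝓝 (embed n t 0 0)] model (deriv s) (Matrix.J (Fin d) ℝ * L) := by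
    intro t
    by_cases ht : |t - r| < r / 2
    · have hmem : embed n t 0 (0 : Trans d) ∈ Metric.ball (embed n r 0 0) χ.rIn := by
        rwa [Metric.mem_ball, dist_embed]
      filter_upwards [χ.eventuallyEq_one_of_mem_ball hmem] with q hq
      rw [hfg, hq, Pi.one_apply, mul_one]
    · have hz : ∀ᶠ x in 𝓝 t, deriv s x = 0 := by
        rcases lt_or_ge t r with h | h
        · rw [abs_of_neg (by linarith)] at ht
          exact (eventually_lt_nhds (by linarith : t < 3 * r / 4)).mono hsd0
        · rw [abs_of_nonneg (by linarith)] at ht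
          exact (eventually_gt_nhds (by linarith : 5 * r / 4 < t)).mono hsd1
      have hx : Filter.Tendsto (fun q : Phase d n => q (ix 0)) (𝓝 (embed n t 0 0)) (𝓝 t) :=
        (hproj (ix 0)).continuous.tendsto _
      filter_upwards [hx.eventually hz] with q hq
      rw [hfg, model, hq]
      simp
  refine ⟨fun q => H₀ q + f q, ⟨?_, ?_, ?_⟩, ?_⟩
  · exact (hproj (iy 0)).add hf
  · have : (fun p => H₀ p + f p - H₀ p) = f := funext fun p => add_sub_cancel_left _ _
    rw [this]
    exact hnorm _ hLη
  · rintro p (hp | hp)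
    -- Outside `B_ρ` the distance to the centre of `χ` is at least `ρ - r ≥ r > 3r/4`, so `f`
    -- vanishes near `p`.
    · have hdist : 3 * r / 4 < dist p (embed n r 0 0) := by
        have h0 : embed n 0 0 (0 : Trans d) = 0 := by
          symm
          exact eq_embed_iff.2 (by simp)
        have h1 := dist_embed (d := d) (n := n) r 0
        rw [h0, sub_zero, abs_of_pos hr] at h1
        have h2 : ρ ≤ dist p 0 := by simpa using hp
        linarith [dist_triangle p (embed n r 0 (0 : Trans d)) 0]
      refine hamVF_congr ?_
      filter_upwards [(continuous_id.dist continuous_const).continuousAt.eventually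
        (eventually_gt_nhds hdist)] with q hq
      rw [hfg, χ.zero_of_le_dist (x := q) (le_of_lt hq), mul_zero, add_zero]
    -- On `Γ₀` the model vanishes to second order in `ŵ` and does not contribute to the field.
    · obtain ⟨t, -, rfl⟩ := mem_Γ₀_iff.1 hp
      rw [hamVF_add_of_eventuallyEq_model hL
        (hds.differentiable (by norm_num) _).hasDerivAt (hmodel t), hamVF_H₀]
      simp
  · exact isLinearPoincareMap_exp hL hA (hs.of_le (by norm_num)) (hs0 0 (by linarith))
      (hs1 1 (by linarith)) (hsd0 0 (by linarith)) (hsd1 1 (by linarith)) hf hfc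
      fun t _ => hmodel t
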